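/- **Theorem.** Fix $p\in(0,1)$ and $\rho\in(0,1)$. Let $\xi(x,t)$ and $U(x,t)$, for $(x,t)\in\mathbb Z^2$, be independent random variables with $\xi(x,t)\sim\mathrm{Bernoulli}(p)$ and $U(x,t)\sim\mathrm{Uniform}[0,1]$, attached to the horizontal edge between $(x,t)$ and $(x+1,t)$. The edge *fires* if $\xi(x,t)=1$. It *stirs* if it fires and has the smallest value of $U$ among the edges of the maximal run of adjacent firing edges of row $t$ that contains it. For $x,t_0\in\mathbb Z$ let $Z_x(t_0)=x$, and for $t>t_0$ let $Z_x(t)$ be - $Z_x(t-1)+1$, if the edge between $(Z_x(t-1),t-1)$ and $(Z_x(t-1)+1,t-1)$ stirs; - $Z_x(t-1)-1$, if the edge between $(Z_x(t-1)-1,t-1)$ and $(Z_x(t-1),t-1)$ stirs; - $Z_x(t-1)$, otherwise. The discrete-time symmetric simple exclusion process (SSEP) started from $\eta_{t_0}\in\{0,1\}^{\mathbb Z}$ at time $t_0$ is given, for $t\ge t_0$, by $\eta_t(x)=1$ if $x=Z_y(t)$ for some $y$ with $\eta_{t_0}(y)=1$, and $\eta_t(x)=0$ otherwise. For $n\in\mathbb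 N$ let $\tilde{\mathbb P}_n$ be the law of $(\eta_t(x),\xi(x,t),U(x,t))_{x\in\mathbb Z,\,t\ge -n}$ when the process starts at time $t_0=-n$ from the product measure of $\mathrm{Bernoulli}(\rho)$ laws, independent of all $(\xi,U)$. Then there is exactly one measure $\tilde{\mathbb P}$ on $\tilde\Omega=(\{0,1\}\times\{0,1\}\times[0,1])^{\mathbb Z^2}$ whose projection to the half-plane $\{t\ge -n\}$ is $\tilde{\mathbb P}_n$ for every $n\in\mathbb N$. It is a probability measure that is invariant under all shifts of $\mathbb Z^2$, and the stationary SSEP system $(\tilde\Omega,\tilde{\mathbb P},\mathbb Z^2)$ has positive entropy. Moreover, its factor on particle configurations, $(\{0,1\}^{\mathbb Z^2},\pi_*\tilde{\mathbb P},\mathbb Z^2)$, where $\pi$ is the projection of every site onto its first coordinate, has positive entropy. Here the entropy of a measure-preserving system $(\Omega,\mathbb P,\{T^z\}_{z\in\mathbb Z^2})$ is $\sup_{\mathcal P}\lim_{L\to\infty}(2L+1)^{-2}H\big(\bigvee_{z\in[-L,L]^2}T^z\mathcal P\big)$, the supremum being over finite measurable partitions $\mathcal P$ of $\Omega$, with $H(\mathcal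 Q)=-\sum_{A\in\mathcal Q}\mathbb P(A)\log\mathbb P(A)$. -/

import Mathlib

open MeasureTheory ProbabilityTheory Filter
open scoped unitInterval

noncomputable section

namespace SSEP

/-! ### Kolmogorov–Sinai entropy of an action of `ℤ²` -/

/-- The square `[-L, L]²` in `ℤ²`. -/
def rect (L : ℕ) : Finset (ℤ × ℤ) :=
  Finset.Icc (-(L : ℤ)) L ×ˢ Finset.Icc (-(L : ℤ)) L

/-- A finite measurable partition is given by its labelling function `P : Ω → Fin k`. This is the
Shannon entropy (natural logarithm) of the common refinement of the partitions `P ∘ T z`, `z ∈ R`: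
the sum of `-μ(A) log μ(A)` over the atoms `A`, which are indexed by the names `a : R → Fin k`. -/
def joinEntropy {Ω : Type*} [MeasurableSpace Ω] (μ : Measure Ω) (T : ℤ × ℤ → Ω → Ω)
    {k : ℕ} (P : Ω → Fin k) (R : Finset (ℤ × ℤ)) : ℝ :=
  ∑ a : R → Fin k, Real.negMulLog (μ.real {ω | ∀ z : R, P (T z.1 ω) = a z})

/-- The entropy rate `lim_{L → ∞} |rect L|⁻¹ H(⋁_{z ∈ rect L} P ∘ T z)` of a finite partition.
For measure-preserving actions the limit exists; it is written as a lower limit. -/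
def partitionEntropy {Ω : Type*} [MeasurableSpace Ω] (μ : Measure Ω) (T : ℤ × ℤ → Ω → Ω)
    {k : ℕ} (P : Ω → Fin k) : EReal :=
  liminf (fun L : ℕ => ((joinEntropy μ T P (rect L) / ((rect L).card : ℝ) : ℝ) : EReal)) atTop

/-- The entropy of a `ℤ²`-action: the supremum of the entropy rates of all finite measurable
partitions. -/
def entropy {Ω : Type*} [MeasurableSpace Ω] (μ : Measure Ω) (T : ℤ × ℤ → Ω → Ω) : EReal :=
  ⨆ (k : ℕ) (P : Ω → Fin k) (_ : Measurable P), partitionEntropy μ T P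

/-- The shift action of `ℤ²` on configurations over `ℤ²`. -/
def shift {A : Type*} (z : ℤ × ℤ) (ω : ℤ × ℤ → A) : ℤ × ℤ → A := fun w => ω (w + z)

/-! ### The stirring process -/

/-- A field of stirring variables: to the horizontal edge between `(x, t)` and `(x + 1, t)`, which
is labelled by its left endpoint `(x, t)`, it assigns the firing variable `ξ` and the tie-breaking
variable `U`. -/
abbrev StirField := ℤ × ℤ → Bool × I

/-- The edges at positions `x` and `y` of row `t` belong to the same run of adjacent edges that
all fire. -/
def SameRun (s : StirField) (t x y : ℤ) : Prop :=
  ∀ z ∈ Set.uIcc x y, (s (z, t)).1 = true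

/-- The edge between `(x, t)` and `(x + 1, t)` stirs: it fires, and it has the smallest
tie-breaking variable in the maximal run of adjacent firing edges that contains it. -/
def Stirs (s : StirField) (x t : ℤ) : Prop :=
  (s (x, t)).1 = true ∧ ∀ y, y ≠ x → SameRun s t x y → (s (x, t)).2 < (s (y, t)).2

open Classical in
/-- The position at time `t₀ + k` of the stirring particle that is at `x` at time `t₀`. -/
def stirPath (s : StirField) (t₀ x : ℤ) : ℕ → ℤ
  | 0 => x
  | k + 1 =>
    if Stirs s (stirPath s t₀ x k) (t₀ + k) then stirPath s t₀ x k + 1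
    else if Stirs s (stirPath s t₀ x k - 1) (t₀ + k) then stirPath s t₀ x k - 1
    else stirPath s t₀ x k

open Classical in
/-- The particle configuration at time `t₀ + k` of the exclusion process that is started from the
configuration `η₀` at time `t₀`. -/
def evolve (s : StirField) (t₀ : ℤ) (η₀ : ℤ → Bool) (k : ℕ) (x : ℤ) : Bool :=
  decide (∃ y, η₀ y = true ∧ stirPath s t₀ y k = x)

/-! ### The laws -/

/-- `({0,1} × {0,1} × [0,1])^{ℤ²}`: the value at `(x, t)` is `(η_t(x), ξ(x,t), U(x,t))`. -/
abbrev Space := ℤ × ℤ → Bool × Bool × I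

/-- The half-plane of the sites `(x, t)` with `t ≥ -n`. -/
abbrev HalfPlane (n : ℕ) := {z : ℤ × ℤ // -(n : ℤ) ≤ z.2}

/-- Independent stirring variables: `ξ` is Bernoulli(`p`) and `U` is uniform on `[0,1]`. -/
def stirLaw (p : I) : Measure StirField :=
  Measure.infinitePi fun _ => (bernoulliMeasure true false p).prod (volume : Measure I)

/-- Independent Bernoulli(`ρ`) initial occupation variables. -/
def initLaw (ρ : I) : Measure (ℤ → Bool) :=
  Measure.infinitePi fun _ => bernoulliMeasure true false ρ

/-- Configuration and stirring variables from time `-n` on, for the process that is started from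
`η₀` at time `-n`. -/
def history (n : ℕ) (q : (ℤ → Bool) × StirField) : HalfPlane n → Bool × Bool × I :=
  fun z => (evolve q.2 (-(n : ℤ)) q.1 (z.1.2 + n).toNat z.1.1, q.2 z.1)

/-- The law, on the half-plane `t ≥ -n`, of the exclusion process with firing parameter `p`
started at time `-n` from the Bernoulli(`ρ`) product measure. -/
def halfPlaneLaw (p ρ : I) (n : ℕ) : Measure (HalfPlane n → Bool × Bool × I) :=
  ((initLaw ρ).prod (stirLaw p)).map (history n)

/-- `μ` is the law of the stationary process on the whole plane: it projects onto all the
half-plane laws. -/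
def IsStationaryLaw (p ρ : I) (μ : Measure Space) : Prop :=
  ∀ n : ℕ, μ.map (fun (ω : Space) (z : HalfPlane n) => ω z.1) = halfPlaneLaw p ρ n

/-- The particle configuration: the projection onto the first coordinate at every site. -/
def particles (ω : Space) : ℤ × ℤ → Bool := fun z => (ω z).1

end SSEP

end

/-!
Why the theorem is true.

*Existence, uniqueness, invariance.* Adjacent edges never stir together
(`Stirs.not_stirs_add_one`), so a row of stirring variables acts on `ℤ` by an involution
(`edgeStep_involutive`), and the dynamics can be run backwards by the same rule. Given the stirring
variables, a step permutes the coordinates of the configuration and hence preserves the Bernoulli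
product measure and keeps it independent of the stirring variables (`measurePreserving_oneStep`).
Hence no extension theorem is needed: `stationaryLaw` is the law of the two-sided evolution
`spaceTime` through a Bernoulli configuration at time `0`, and its restriction to times `t ≥ -n` is
the process started at time `-n` (`isStationaryLaw_stationaryLaw`). Half-planes exhaust the finite
sets of sites, which gives uniqueness (`IsStationaryLaw.eq_stationaryLaw`), and shifting the plane
amounts to evolving and translating the pair of configuration and stirring variables
(`shift_spaceTime`), which gives shift invariance.

*Entropy.* Entropy does not increase under factors (`entropy_map_le`), so the particle
configurations suffice. Group the edges of each row in disjoint blocks `3k - 1`, `3k`, `3k + 1`. If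
the outer edges of a block do not fire and the sites `3k`, `3k + 1` are occupied differently, then
the next configuration shows whether the edge `3k` fires (`fires_of_isolated`). So the event that
the configuration on a square equals `a` forces, in each block whose inner sites `a` occupies
differently, an event of probability at most `blockProb p < 1`; as blocks are independent, the event
has probability at most `blockProb p` to the number of such blocks (`atom_real_le`). Taking the
expectation of `-log` of this bound (`mul_sum_le_joinEntropy`), the entropy of the square is at
least a positive constant times the expected number of such blocks, which by stationarity is
proportional to the area, because two neighbouring sites differ with positive probability
(`unequalProb_pos`).
-/

noncomputable section

namespace SSEP

/-! ### One row of the stirring process -/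

open Classical in
/-- The displacement of the stirring particles by row `t`: the two endpoints of every stirring edge
are exchanged. -/
def edgeStep (s : StirField) (t x : ℤ) : ℤ :=
  if Stirs s x t then x + 1 else if Stirs s (x - 1) t then x - 1 else x

lemma stirPath_succ (s : StirField) (t₀ x : ℤ) (k : ℕ) :
    stirPath s t₀ x (k + 1) = edgeStep s (t₀ + k) (stirPath s t₀ x k) := rfl

/-- Stirring edges form a matching, because adjacent firing edges compete with each other. -/
lemma Stirs.not_stirs_add_one {s : StirField} {x t : ℤ} (h : Stirs s x t) :
    ¬ Stirs s (x + 1) t := by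
  intro h'
  have fires : ∀ z, x ≤ z → z ≤ x + 1 → (s (z, t)).1 = true := by
    intro z h₁ h₂
    obtain rfl | rfl : z = x ∨ z = x + 1 := by omega
    exacts [h.1, h'.1]
  have h₁ : (s (x, t)).2 < (s (x + 1, t)).2 := h.2 _ (by omega) fun z hz => by
    rw [Set.uIcc_of_le (by omega)] at hz
    exact fires z hz.1 hz.2
  have h₂ : (s (x + 1, t)).2 < (s (x, t)).2 := h'.2 _ (by omega) fun z hz => by
    rw [Set.uIcc_of_ge (by omega)] at hz
    exact fires z hz.1 hz.2
  exact lt_asymm h₁ h₂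

lemma edgeStep_involutive (s : StirField) (t : ℤ) : Function.Involutive (edgeStep s t) := by
  intro x
  by_cases h : Stirs s x t
  · simp [edgeStep, h, h.not_stirs_add_one]
  · by_cases h' : Stirs s (x - 1) t <;> simp [edgeStep, h, h']

lemma evolve_zero (s : StirField) (t₀ : ℤ) (η : ℤ → Bool) : evolve s t₀ η 0 = η := by
  funext x
  simp [evolve, stirPath]

/-- As one row acts by an involution, the particle that arrives at `x` is the one that was at
`edgeStep s _ x` before. -/
lemma evolve_succ (s : StirField) (t₀ : ℤ) (η : ℤ → Bool) (k : ℕ) (x : ℤ) :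
    evolve s t₀ η (k + 1) x = evolve s t₀ η k (edgeStep s (t₀ + k) x) := by
  have h (y : ℤ) : edgeStep s (t₀ + k) (stirPath s t₀ y k) = x ↔
      stirPath s t₀ y k = edgeStep s (t₀ + k) x := by
    rw [(edgeStep_involutive s _).eq_iff, eq_comm]
  rw [evolve, evolve, decide_eq_decide]
  simp only [stirPath_succ, h]

/-- An edge whose two neighbours do not fire stirs as soon as it fires. -/
lemma edgeStep_of_isolated {s : StirField} {x t : ℤ} (h₁ : (s (x - 1, t)).1 = false)
    (h₂ : (s (x + 1, t)).1 = false) :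
    edgeStep s t x = if (s (x, t)).1 then x + 1 else x := by
  have hl : ¬ Stirs s (x - 1) t := fun h => by simpa [h₁] using h.1
  cases h : (s (x, t)).1
  · have : ¬ Stirs s x t := fun h' => by simpa [h] using h'.1
    simp [edgeStep, this, hl]
  · have : Stirs s x t := by
      refine ⟨h, fun y hy hrun => ?_⟩
      rcases lt_or_gt_of_ne hy with hy | hy
      · have := hrun (x - 1) (by rw [Set.uIcc_of_ge hy.le]; constructor <;> omega)
        simp [h₁] at this
      · have := hrun (x + 1) (by rw [Set.uIcc_of_le hy.le]; constructor <;> omega)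
        simp [h₂] at this
    simp [edgeStep, this]

lemma sameRun_shift (s : StirField) (z : ℤ × ℤ) (t x y : ℤ) :
    SameRun (shift z s) t x y ↔ SameRun s (t + z.2) (x + z.1) (y + z.1) := by
  obtain ⟨a, b⟩ := z
  simp only [SameRun, shift, Prod.mk_add_mk, Set.mem_uIcc]
  constructor
  · intro h w hw
    simpa using h (w - a) (by omega)
  · intro h w hw
    exact h (w + a) (by omega)

lemma stirs_shift (s : StirField) (z : ℤ × ℤ) (x t : ℤ) :
    Stirs (shift z s) x t ↔ Stirs s (x + z.1) (t + z.2) := by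
  obtain ⟨a, b⟩ := z
  simp only [Stirs, sameRun_shift, shift, Prod.mk_add_mk]
  refine and_congr_right fun _ => ⟨fun h y hy hr => ?_, fun h y hy hr => ?_⟩
  · simpa using h (y - a) (by omega) (by simpa using hr)
  · exact h _ (by omega) hr

lemma edgeStep_shift (s : StirField) (z : ℤ × ℤ) (t x : ℤ) :
    edgeStep (shift z s) t x = edgeStep s (t + z.2) (x + z.1) - z.1 := by
  have : x - 1 + z.1 = x + z.1 - 1 := by ring
  have h₁ := stirs_shift s z x t
  have h₂ := stirs_shift s z (x - 1) t
  rw [this] at h₂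
  unfold edgeStep
  by_cases h : Stirs s (x + z.1) (t + z.2)
  · rw [if_pos h, if_pos (h₁.2 h)]
    ring
  · rw [if_neg h, if_neg (h ∘ h₁.1)]
    by_cases h' : Stirs s (x + z.1 - 1) (t + z.2)
    · rw [if_pos h', if_pos (h₂.2 h')]
      ring
    · rw [if_neg h', if_neg (h' ∘ h₂.1)]
      ring

/-! ### The dynamics in both directions of time -/

/-- The effect of row `t` on the particle configuration. As the row acts by an involution, this is
the step from time `t` to time `t + 1` as well as the step back. -/
def oneStep (t : ℤ) (q : (ℤ → Bool) × StirField) : (ℤ → Bool) × StirField :=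
  (fun x => q.1 (edgeStep q.2 t x), q.2)

lemma oneStep_involutive (t : ℤ) : Function.Involutive (oneStep t) := by
  intro q
  simp [oneStep, edgeStep_involutive q.2 t _]

/-- The evolution from time `0` to time `t`, for `t` of either sign; the stirring variables are
carried along unchanged. -/
def timeMap : ℤ → (ℤ → Bool) × StirField → (ℤ → Bool) × StirField
  | Int.ofNat n => Nat.rec id (fun k f => oneStep k ∘ f) n
  | Int.negSucc n => Nat.rec (oneStep (-1)) (fun k f => oneStep (Int.negSucc (k + 1)) ∘ f) n

lemma timeMap_zero : timeMap 0 = id := rfl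

lemma timeMap_add_one (t : ℤ) (q : (ℤ → Bool) × StirField) :
    timeMap (t + 1) q = oneStep t (timeMap t q) := by
  match t with
  | Int.ofNat n => rfl
  | Int.negSucc 0 =>
    exact (oneStep_involutive (-1) q).symm
  | Int.negSucc (n + 1) =>
    exact (oneStep_involutive (Int.negSucc (n + 1)) (timeMap (Int.negSucc n) q)).symm

lemma timeMap_sub_one (t : ℤ) (q : (ℤ → Bool) × StirField) :
    timeMap (t - 1) q = oneStep (t - 1) (timeMap t q) := by
  have h := timeMap_add_one (t - 1) q
  rw [sub_add_cancel] at h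
  rw [h, oneStep_involutive]

lemma timeMap_snd (t : ℤ) (q : (ℤ → Bool) × StirField) : (timeMap t q).2 = q.2 := by
  induction t using Int.induction_on with
  | zero => simp [timeMap_zero]
  | succ n ih => rw [timeMap_add_one, oneStep, ih]
  | pred n ih => rw [timeMap_sub_one, oneStep, ih]

lemma timeMap_add_one_fst (t : ℤ) (q : (ℤ → Bool) × StirField) (x : ℤ) :
    (timeMap (t + 1) q).1 x = (timeMap t q).1 (edgeStep q.2 t x) := by
  rw [timeMap_add_one, oneStep, timeMap_snd]

/-- The evolution is determined by its recursion and the configuration at time `0`. -/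
lemma eq_timeMap_fst {s : StirField} {c : ℤ → ℤ → Bool}
    (hc : ∀ t x, c (t + 1) x = c t (edgeStep s t x)) (t : ℤ) :
    c t = (timeMap t (c 0, s)).1 := by
  induction t using Int.induction_on with
  | zero => simp [timeMap_zero]
  | succ n ih =>
    funext x
    rw [hc, ih, timeMap_add_one_fst]
  | pred n ih =>
    have hc' := hc (-(n : ℤ) - 1)
    rw [sub_add_cancel] at hc'
    funext x
    rw [timeMap_sub_one, oneStep, timeMap_snd, ← ih]
    simp only [hc', edgeStep_involutive s _ x]

lemma timeMap_add_natCast_fst (t : ℤ) (k : ℕ) (q : (ℤ → Bool) × StirField) :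
    (timeMap (t + k) q).1 = evolve q.2 t (timeMap t q).1 k := by
  induction k with
  | zero => simp [evolve_zero]
  | succ k ih =>
    funext x
    rw [evolve_succ, ← ih, Nat.cast_succ, ← add_assoc, timeMap_add_one_fst]

/-- The whole space-time configuration, given the particles at time `0` and the stirring
variables. -/
def spaceTime (q : (ℤ → Bool) × StirField) : Space :=
  fun z => ((timeMap z.2 q).1 z.1, q.2 z)

/-- The law of the two-sided evolution that is at time `0` in the Bernoulli(`ρ`) measure. -/
def stationaryLaw (p ρ : I) : Measure Space :=
  ((initLaw ρ).prod (stirLaw p)).map spaceTime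

lemma spaceTime_restrict (n : ℕ) (q : (ℤ → Bool) × StirField) :
    (fun z : HalfPlane n => spaceTime q z.1) = history n (timeMap (-n) q) := by
  funext z
  have hz : (-(n : ℤ)) + ((z.1.2 + n).toNat : ℤ) = z.1.2 := by
    have := z.2
    omega
  simp only [spaceTime, history]
  rw [timeMap_snd, ← timeMap_add_natCast_fst, hz]

lemma shift_spaceTime (z : ℤ × ℤ) (q : (ℤ → Bool) × StirField) :
    shift z (spaceTime q) =
      spaceTime (fun x => (timeMap z.2 q).1 (x + z.1), shift z q.2) := by
  have key := eq_timeMap_fst (s := shift z q.2)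
    (c := fun t x => (timeMap (t + z.2) q).1 (x + z.1)) fun t x => by
      rw [add_right_comm, timeMap_add_one_fst, edgeStep_shift, sub_add_cancel]
  funext w
  have := congrFun (key w.2) w.1
  simp only [zero_add] at this
  simp only [shift, spaceTime, Prod.fst_add, Prod.snd_add, this]

/-! ### Measurability and invariance of the laws -/

instance (ρ : I) : IsProbabilityMeasure (initLaw ρ) := by
  unfold initLaw; infer_instance

instance (p : I) : IsProbabilityMeasure (stirLaw p) := by
  unfold stirLaw; infer_instance

lemma measurableSet_stirs (x t : ℤ) : MeasurableSet {s : StirField | Stirs s x t} := by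
  have hfire (z : ℤ) : MeasurableSet {s : StirField | (s (z, t)).1 = true} :=
    measurableSet_eq_fun (by fun_prop) measurable_const
  have hrun (y : ℤ) : MeasurableSet {s : StirField | SameRun s t x y} := by
    simp only [SameRun, Set.ofPred_forall]
    exact .iInter fun z => .iInter fun _ => hfire z
  have hlt (y : ℤ) : MeasurableSet {s : StirField | (s (x, t)).2 < (s (y, t)).2} :=
    measurableSet_lt (by fun_prop) (by fun_prop)
  refine (hfire x).inter ?_
  have : {s : StirField | ∀ y, y ≠ x → SameRun s t x y → (s (x, t)).2 < (s (y, t)).2} =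
      ⋂ y, ⋂ _ : y ≠ x, ({s | SameRun s t x y}ᶜ ∪ {s | (s (x, t)).2 < (s (y, t)).2}) := by
    ext s
    simp [imp_iff_not_or]
  change MeasurableSet {s : StirField | ∀ y, y ≠ x → SameRun s t x y → _}
  rw [this]
  exact .iInter fun y => .iInter fun _ => (hrun y).compl.union (hlt y)

lemma measurable_edgeStep (t x : ℤ) : Measurable fun s : StirField => edgeStep s t x :=
  .ite (measurableSet_stirs x t) measurable_const
    (.ite (measurableSet_stirs (x - 1) t) measurable_const measurable_const)

lemma measurable_oneStep (t : ℤ) : Measurable (oneStep t) := by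
  refine Measurable.prodMk (measurable_pi_lambda _ fun x => ?_) measurable_snd
  have h : Measurable fun y : (ℤ → Bool) × ℤ => y.1 y.2 :=
    measurable_from_prod_countable_left fun x => measurable_pi_apply x
  exact h.comp (measurable_fst.prodMk ((measurable_edgeStep t x).comp measurable_snd))

lemma measurable_evolve (t₀ : ℤ) (k : ℕ) (x : ℤ) :
    Measurable fun q : (ℤ → Bool) × StirField => evolve q.2 t₀ q.1 k x := by
  induction k generalizing x with
  | zero =>
    simp only [evolve_zero]
    fun_prop
  | succ k ih =>
    simp only [evolve_succ]
    have h : Measurable fun y : ((ℤ → Bool) × StirField) × ℤ => evolve y.1.2 t₀ y.1.1 k y.2 :=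
      measurable_from_prod_countable_left ih
    exact h.comp (measurable_id.prodMk ((measurable_edgeStep (t₀ + k) x).comp measurable_snd))

lemma measurable_history (n : ℕ) : Measurable (history n) :=
  measurable_pi_lambda _ fun z =>
    (measurable_evolve _ _ _).prodMk ((measurable_pi_apply z.1).comp measurable_snd)

/-- The law of an i.i.d. field does not change under an injective relabelling of the sites. -/
lemma measurePreserving_comp_infinitePi {ι κ X : Type*} [MeasurableSpace X] (μ : Measure X)
    [IsProbabilityMeasure μ] {f : κ → ι} (hf : Function.Injective f) :
    MeasurePreserving (fun (ω : ι → X) (k : κ) => ω (f k))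
      (Measure.infinitePi fun _ => μ) (Measure.infinitePi fun _ => μ) :=
  ⟨by fun_prop, Measure.map_infinitePi_infinitePi_of_inj (P := fun _ => μ) hf⟩

/-- Given the stirring variables, a step permutes the i.i.d. occupation variables, so it preserves
their law and keeps them independent of the stirring variables. -/
lemma measurePreserving_oneStep (p ρ : I) (t : ℤ) :
    MeasurePreserving (oneStep t) ((initLaw ρ).prod (stirLaw p))
      ((initLaw ρ).prod (stirLaw p)) := by
  have h : MeasurePreserving
      (fun q : StirField × (ℤ → Bool) => (q.1, fun x => q.2 (edgeStep q.1 t x)))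
      ((stirLaw p).prod (initLaw ρ)) ((stirLaw p).prod (initLaw ρ)) := by
    refine (MeasurePreserving.id (stirLaw p)).skew_product
      (g := fun s (η : ℤ → Bool) x => η (edgeStep s t x)) ?_ ?_
    · exact measurable_fst.comp ((measurable_oneStep t).comp measurable_swap)
    · exact ae_of_all _ fun s =>
        (measurePreserving_comp_infinitePi _ (edgeStep_involutive s t).injective).map_eq
  exact (Measure.measurePreserving_swap.comp h).comp Measure.measurePreserving_swap

lemma measurePreserving_timeMap (p ρ : I) (t : ℤ) :
    MeasurePreserving (timeMap t) ((initLaw ρ).prod (stirLaw p))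
      ((initLaw ρ).prod (stirLaw p)) := by
  induction t using Int.induction_on with
  | zero =>
    rw [timeMap_zero]
    exact MeasurePreserving.id _
  | succ n ih =>
    rw [show timeMap ((n : ℤ) + 1) = oneStep n ∘ timeMap n from funext (timeMap_add_one _)]
    exact (measurePreserving_oneStep p ρ _).comp ih
  | pred n ih =>
    rw [show timeMap (-(n : ℤ) - 1) = oneStep (-n - 1) ∘ timeMap (-n) from
      funext (timeMap_sub_one _)]
    exact (measurePreserving_oneStep p ρ _).comp ih

lemma measurable_timeMap (t : ℤ) : Measurable (timeMap t) :=
  (measurePreserving_timeMap 0 0 t).measurable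

lemma measurable_spaceTime : Measurable spaceTime :=
  measurable_pi_lambda _ fun z =>
    ((measurable_pi_apply z.1).comp (measurable_fst.comp (measurable_timeMap z.2))).prodMk
      ((measurable_pi_apply z).comp measurable_snd)

lemma measurable_shift {A : Type*} [MeasurableSpace A] (z : ℤ × ℤ) :
    Measurable (shift z : (ℤ × ℤ → A) → ℤ × ℤ → A) :=
  measurable_pi_lambda _ fun _ => measurable_pi_apply _

lemma measurable_particles : Measurable particles :=
  measurable_pi_lambda _ fun z => measurable_fst.comp (measurable_pi_apply z)

lemma particles_shift (z : ℤ × ℤ) (ω : Space) :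
    particles (shift z ω) = shift z (particles ω) := rfl

lemma isStationaryLaw_stationaryLaw (p ρ : I) : IsStationaryLaw p ρ (stationaryLaw p ρ) := by
  intro n
  rw [stationaryLaw, Measure.map_map (by fun_prop) measurable_spaceTime, halfPlaneLaw]
  have : (fun (ω : Space) (z : HalfPlane n) => ω z.1) ∘ spaceTime =
      history n ∘ timeMap (-n) := funext (spaceTime_restrict n)
  rw [this, ← Measure.map_map (measurable_history n) (measurable_timeMap _),
    (measurePreserving_timeMap p ρ _).map_eq]

instance (p ρ : I) : IsProbabilityMeasure (stationaryLaw p ρ) :=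
  Measure.isProbabilityMeasure_map measurable_spaceTime.aemeasurable

/-- Every finite set of sites lies in a half-plane, so the half-plane laws determine the
finite-dimensional distributions. -/
lemma IsStationaryLaw.eq_stationaryLaw {p ρ : I} {μ : Measure Space}
    (hμ : IsStationaryLaw p ρ μ) : μ = stationaryLaw p ρ := by
  refine IsProjectiveLimit.unique (P := fun J => (stationaryLaw p ρ).map J.restrict)
    (fun J => ?_) fun J => rfl
  obtain ⟨n, hn⟩ : ∃ n : ℕ, ∀ z ∈ J, -(n : ℤ) ≤ z.2 := by
    refine ⟨∑ z ∈ J, z.2.natAbs, fun z hz => ?_⟩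
    have : z.2.natAbs ≤ ∑ z ∈ J, z.2.natAbs :=
      Finset.single_le_sum (f := fun z : ℤ × ℤ => z.2.natAbs) (fun _ _ => Nat.zero_le _) hz
    omega
  have hr : (J.restrict : Space → _) =
      (fun (ω : HalfPlane n → Bool × Bool × I) (z : J) => ω ⟨z.1, hn z.1 z.2⟩) ∘
        fun (ω : Space) (z : HalfPlane n) => ω z.1 := rfl
  have hm : Measurable
      (fun (ω : HalfPlane n → Bool × Bool × I) (z : J) => ω ⟨z.1, hn z.1 z.2⟩) := by fun_prop
  have hm' : Measurable fun (ω : Space) (z : HalfPlane n) => ω z.1 := by fun_prop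
  change μ.map J.restrict = (stationaryLaw p ρ).map J.restrict
  rw [hr, ← Measure.map_map hm hm', ← Measure.map_map hm hm', hμ n,
    isStationaryLaw_stationaryLaw p ρ n]

lemma measurePreserving_shift_stationaryLaw (p ρ : I) (z : ℤ × ℤ) :
    MeasurePreserving (shift z) (stationaryLaw p ρ) (stationaryLaw p ρ) := by
  refine ⟨measurable_shift z, ?_⟩
  let f (q : (ℤ → Bool) × StirField) : (ℤ → Bool) × StirField :=
    (fun x => q.1 (x + z.1), shift z q.2)
  have h : MeasurePreserving f ((initLaw ρ).prod (stirLaw p)) ((initLaw ρ).prod (stirLaw p)) :=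
    (measurePreserving_comp_infinitePi _ (add_left_injective z.1)).prod
      (measurePreserving_comp_infinitePi _ (add_left_injective z))
  have h' := h.comp (measurePreserving_timeMap p ρ z.2)
  have hc : shift z ∘ spaceTime = spaceTime ∘ f ∘ timeMap z.2 := by
    funext q
    simp only [f, Function.comp_apply, shift_spaceTime, timeMap_snd]
  rw [stationaryLaw, Measure.map_map (measurable_shift z) measurable_spaceTime, hc,
    ← Measure.map_map measurable_spaceTime h'.measurable, h'.map_eq]

/-! ### Entropy of factors -/

section Entropy

variable {Ω Ω' : Type*} [MeasurableSpace Ω] [MeasurableSpace Ω'] {μ : Measure Ω}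
  {T : ℤ × ℤ → Ω → Ω} {T' : ℤ × ℤ → Ω' → Ω'} {k : ℕ}

lemma measurableSet_atom (hT : ∀ z, Measurable (T z)) {P : Ω → Fin k} (hP : Measurable P)
    (R : Finset (ℤ × ℤ)) (a : R → Fin k) :
    MeasurableSet {ω | ∀ z : R, P (T z.1 ω) = a z} := by
  rw [Set.ofPred_forall]
  exact .iInter fun z => (hP.comp (hT z.1)) (measurableSet_singleton (a z))

/-- A finite partition of a factor pulls back to a partition with the same entropy rate. -/
lemma entropy_map_le {π : Ω → Ω'} (hπ : Measurable π) (hT' : ∀ z, Measurable (T' z))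
    (hπT : ∀ z ω, π (T z ω) = T' z (π ω)) : entropy (μ.map π) T' ≤ entropy μ T := by
  refine iSup_le fun k => iSup_le fun P => iSup_le fun hP => ?_
  refine le_trans (le_of_eq ?_)
    (le_iSup_of_le k (le_iSup_of_le (P ∘ π) (le_iSup_of_le (hP.comp hπ) le_rfl)))
  have h (R : Finset (ℤ × ℤ)) : joinEntropy (μ.map π) T' P R = joinEntropy μ T (P ∘ π) R := by
    refine Finset.sum_congr rfl fun a _ => ?_
    rw [measureReal_def, Measure.map_apply hπ (measurableSet_atom hT' hP R a), measureReal_def]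
    simp only [Set.preimage_ofPred_eq, Function.comp_apply, hπT]
  simp only [partitionEntropy, h]

/-- A lower bound of the Shannon entropy: if every atom `a` has measure at most `r ^ n(a)`, where
`n(a)` counts the events of a family `E i`, `i ∈ J`, that contain `a`, then the entropy is at least
`-log r` times the expected number of these events. -/
lemma mul_sum_le_joinEntropy [IsFiniteMeasure μ] (hT : ∀ z, Measurable (T z)) {P : Ω → Fin k}
    (hP : Measurable P) (R : Finset (ℤ × ℤ)) {ι : Type*} (J : Finset ι)
    (E : ι → (R → Fin k) → Prop) [∀ i, DecidablePred (E i)] {r : ℝ}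
    (h : ∀ a, μ.real {ω | ∀ z : R, P (T z.1 ω) = a z} ≤ r ^ (J.filter fun i => E i a).card) :
    -Real.log r * ∑ i ∈ J, μ.real {ω | E i fun z : R => P (T z.1 ω)} ≤ joinEntropy μ T P R := by
  set name : Ω → R → Fin k := fun ω z => P (T z.1 ω)
  have hatom (a : R → Fin k) : {ω | ∀ z : R, P (T z.1 ω) = a z} = name ⁻¹' {a} := by
    ext ω
    simp [name, funext_iff]
  have hmeas (a : R → Fin k) : MeasurableSet (name ⁻¹' {a}) :=
    hatom a ▸ measurableSet_atom hT hP R a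
  have hE (i : ι) : μ.real {ω | E i (name ω)} =
      ∑ a, if E i a then μ.real (name ⁻¹' {a}) else 0 := by
    rw [← Finset.sum_filter, ← measureReal_biUnion_finset]
    · congr 1
      ext ω
      simp
    · exact fun a _ b _ hab => Disjoint.preimage _ (by simpa using hab)
    · exact fun a _ => hmeas a
  change -Real.log r * ∑ i ∈ J, μ.real {ω | E i (name ω)} ≤ _
  simp only [hE, joinEntropy, hatom]
  rw [Finset.sum_comm, Finset.mul_sum]
  refine Finset.sum_le_sum fun a _ => ?_
  rw [← Finset.sum_filter, Finset.sum_const, nsmul_eq_mul, Real.negMulLog]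
  -- compare `-log` with the bound; atoms of measure zero contribute nothing to either side
  rcases (measureReal_nonneg (μ := μ) (s := name ⁻¹' {a})).eq_or_lt with h0 | h0
  · simp [← h0]
  · have := Real.log_le_log h0 (hatom a ▸ h a)
    rw [Real.log_pow] at this
    nlinarith

end Entropy

/-! ### Constraints on the firing variables -/

/-- The largest probability that, of three adjacent edges, either an outer one fires or the firing
variable of the middle one has a prescribed value. -/
def blockProb (p : I) : ℝ := 1 - (1 - p) ^ 2 * min (p : ℝ) (1 - p)

lemma blockProb_mem_Ioo {p : I} (hp₀ : 0 < p) (hp₁ : p < 1) :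
    blockProb p ∈ Set.Ioo (0 : ℝ) 1 := by
  have h₀ : (0 : ℝ) < p := hp₀
  have h₁ : (0 : ℝ) < 1 - p := sub_pos.2 hp₁
  have hmin : 0 < min (p : ℝ) (1 - p) := lt_min h₀ h₁
  have hsq : (1 - (p : ℝ)) ^ 2 < 1 := by nlinarith
  have hlt : min (p : ℝ) (1 - p) < 1 := (min_le_right _ _).trans_lt (by linarith)
  constructor
  · unfold blockProb
    nlinarith [sq_nonneg (1 - (p : ℝ))]
  · unfold blockProb
    have : 0 < (1 - (p : ℝ)) ^ 2 * min (p : ℝ) (1 - p) := by positivity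
    linarith

/-- The edges `3k - 1`, `3k`, `3k + 1` of row `t` form the block `(k, t)`, and `v i` holds the
variables of the edge `3k - 1 + i`. This is the event that either an outer edge fires or the firing
variable of the middle edge is `c`. -/
def blockSet (c : Bool) : Set (Fin 3 → Bool × I) :=
  {v | (v 0).1 = false → (v 2).1 = false → (v 1).1 = c}

lemma blockSet_eq (c : Bool) : blockSet c =
    (Set.univ.pi ![{u : Bool × I | u.1 = false}, {u : Bool × I | u.1 = !c},
      {u : Bool × I | u.1 = false}])ᶜ := by
  ext v
  simp only [blockSet, Set.mem_ofPred_eq, Set.mem_compl_iff, Set.mem_univ_pi,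
    Fin.forall_fin_succ, Matrix.cons_val_zero, Matrix.cons_val_succ]
  cases (v 0).1 <;> cases h₁ : (v 1).1 <;> cases h₂ : (v 2).1 <;> cases c <;> simp [h₁, h₂]

lemma measurableSet_fst_eq (b : Bool) : MeasurableSet {u : Bool × I | u.1 = b} :=
  measurable_fst (measurableSet_singleton b)

lemma measurableSet_blockSet (c : Bool) : MeasurableSet (blockSet c) := by
  rw [blockSet_eq]
  refine (MeasurableSet.univ_pi fun i => ?_).compl
  fin_cases i <;> exact measurableSet_fst_eq _

lemma firing_real (p : I) (b : Bool) :
    ((bernoulliMeasure true false p).prod (volume : Measure I)).real {u | u.1 = b} =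
      if b then (p : ℝ) else 1 - p := by
  have : {u : Bool × I | u.1 = b} = {b} ×ˢ Set.univ := by ext; simp
  rw [this, measureReal_prod_prod]
  cases b <;> simp

lemma blockSet_real_le (p : I) (c : Bool) :
    (Measure.infinitePi fun _ : Fin 3 =>
      (bernoulliMeasure true false p).prod (volume : Measure I)).real (blockSet c) ≤
      blockProb p := by
  have hm : MeasurableSet (Set.univ.pi ![{u : Bool × I | u.1 = false}, {u : Bool × I | u.1 = !c},
      {u : Bool × I | u.1 = false}]) := by
    simpa [blockSet_eq] using (measurableSet_blockSet c).compl
  have hnn : (0 : ℝ) ≤ (1 - p) ^ 2 := sq_nonneg _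
  rw [blockSet_eq, probReal_compl_eq_one_sub hm, Measure.infinitePi_eq_pi, measureReal_def,
    Measure.pi_pi, ENNReal.toReal_prod, blockProb]
  simp only [← measureReal_def, Fin.prod_univ_three]
  simp only [Matrix.cons_val, firing_real]
  cases c
  · have := mul_le_mul_of_nonneg_left (min_le_left (p : ℝ) (1 - p)) hnn
    simp only [Bool.not_false, if_true, Bool.false_eq_true, if_false]
    linarith
  · have := mul_le_mul_of_nonneg_left (min_le_right (p : ℝ) (1 - p)) hnn
    simp only [Bool.not_true, Bool.false_eq_true, if_false]
    linarith

/-- The blocks are disjoint, hence independent. -/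
lemma stirLaw_real_blocks_le (p : I) (G : Finset (ℤ × ℤ)) (c : ℤ × ℤ → Bool) :
    (stirLaw p).real {s | ∀ z ∈ G, (s (3 * z.1 - 1, z.2)).1 = false →
      (s (3 * z.1 + 1, z.2)).1 = false → (s (3 * z.1, z.2)).1 = c z} ≤ blockProb p ^ G.card := by
  set ν := (bernoulliMeasure true false p).prod (volume : Measure I)
  have hinj : Function.Injective
      fun w : (ℤ × ℤ) × Fin 3 => ((3 * w.1.1 - 1 + (w.2 : ℕ), w.1.2) : ℤ × ℤ) := by
    rintro ⟨⟨a, b⟩, i⟩ ⟨⟨a', b'⟩, i'⟩ h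
    have h1 := congrArg Prod.fst h
    have h2 := congrArg Prod.snd h
    simp only at h1 h2
    have := i.2
    have := i'.2
    have hi : i = i' := Fin.ext (by omega)
    have ha : a = a' := by omega
    rw [hi, ha, h2]
  have hb : MeasurePreserving (fun (s : StirField) (z : ℤ × ℤ) (i : Fin 3) =>
      s (3 * z.1 - 1 + (i : ℕ), z.2)) (stirLaw p)
      (Measure.infinitePi fun _ : ℤ × ℤ => Measure.infinitePi fun _ : Fin 3 => ν) :=
    MeasurePreserving.comp ⟨by fun_prop, Measure.infinitePi_map_curry fun _ _ => ν⟩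
      (measurePreserving_comp_infinitePi ν hinj)
  have hset : {s : StirField | ∀ z ∈ G, (s (3 * z.1 - 1, z.2)).1 = false →
      (s (3 * z.1 + 1, z.2)).1 = false → (s (3 * z.1, z.2)).1 = c z} =
      (fun (s : StirField) (z : ℤ × ℤ) (i : Fin 3) => s (3 * z.1 - 1 + (i : ℕ), z.2)) ⁻¹'
        Set.pi G fun z => blockSet (c z) := by
    ext s
    have e (a : ℤ) : 3 * a - 1 + 2 = 3 * a + 1 := by ring
    simp [blockSet, e]
  have hm : MeasurableSet (Set.pi (G : Set (ℤ × ℤ)) fun z => blockSet (c z)) :=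
    .pi G.countable_toSet fun z _ => measurableSet_blockSet _
  rw [hset, measureReal_def, hb.measure_preimage hm.nullMeasurableSet,
    Measure.infinitePi_pi _ fun z _ => measurableSet_blockSet _, ENNReal.toReal_prod,
    ← Finset.prod_const]
  exact Finset.prod_le_prod (fun _ _ => ENNReal.toReal_nonneg)
    fun z _ => blockSet_real_le p (c z)

/-- If the outer edges of a block do not fire and the inner sites are occupied differently, then
the next configuration reveals whether the middle edge fires. -/
lemma fires_of_isolated (q : (ℤ → Bool) × StirField) {x t : ℤ}
    (h₁ : (q.2 (x - 1, t)).1 = false) (h₂ : (q.2 (x + 1, t)).1 = false)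
    (hne : (spaceTime q (x, t)).1 ≠ (spaceTime q (x + 1, t)).1) :
    (q.2 (x, t)).1 = ((spaceTime q (x, t)).1 ^^ (spaceTime q (x, t + 1)).1) := by
  have h := timeMap_add_one_fst t q x
  rw [edgeStep_of_isolated h₁ h₂] at h
  simp only [spaceTime] at hne ⊢
  rw [h]
  cases hq : (q.2 (x, t)).1
  · simp
  · simp only [if_true]
    revert hne
    cases (timeMap t q).1 x <;> cases (timeMap t q).1 (x + 1) <;> simp

/-! ### Positive entropy of the particle configurations -/

/-- The partition of the particle configurations by the occupation of the origin. -/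
def originState (ω : ℤ × ℤ → Bool) : Fin 2 := if ω 0 then 1 else 0

lemma measurable_originState : Measurable originState :=
  (measurable_of_finite fun b : Bool => if b then (1 : Fin 2) else 0).comp (measurable_pi_apply 0)

lemma originState_shift (z : ℤ × ℤ) (ω : ℤ × ℤ → Bool) :
    originState (shift z ω) = if ω z then 1 else 0 := by
  simp [originState, shift]

lemma particleLaw_eq (p ρ : I) : (stationaryLaw p ρ).map particles =
    ((initLaw ρ).prod (stirLaw p)).map (particles ∘ spaceTime) := by
  rw [stationaryLaw, Measure.map_map measurable_particles measurable_spaceTime]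

instance (p ρ : I) : IsProbabilityMeasure ((stationaryLaw p ρ).map particles) :=
  Measure.isProbabilityMeasure_map measurable_particles.aemeasurable

/-- The blocks whose inner sites, at the time of the block and at the next time, are used in
`rect L`. -/
def blocks (L : ℕ) : Finset (ℤ × ℤ) :=
  (Finset.range ((L + 2) / 3) ×ˢ Finset.range L).map
    (Nat.castEmbedding.prodMap Nat.castEmbedding)

lemma card_blocks (L : ℕ) : (blocks L).card = (L + 2) / 3 * L := by
  simp [blocks]

lemma mem_rect_of_mem_blocks {L : ℕ} {z : ℤ × ℤ} (hz : z ∈ blocks L) :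
    (3 * z.1, z.2) ∈ rect L ∧ (3 * z.1 + 1, z.2) ∈ rect L ∧ (3 * z.1, z.2 + 1) ∈ rect L := by
  simp only [blocks, Finset.mem_map, Finset.mem_product, Finset.mem_range] at hz
  obtain ⟨⟨a, b⟩, ⟨ha, hb⟩, rfl⟩ := hz
  simp only at ha hb
  simp only [rect, Finset.mem_product, Finset.mem_Icc, Function.Embedding.coe_prodMap, Prod.map,
    Nat.castEmbedding_apply]
  omega

/-- A name on `rect L`, extended to a configuration of the plane. -/
def extendName {L : ℕ} (a : rect L → Fin 2) (z : ℤ × ℤ) : Bool :=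
  if h : z ∈ rect L then decide (a ⟨z, h⟩ = 1) else false

lemma extendName_eq {L : ℕ} (ω : ℤ × ℤ → Bool) {z : ℤ × ℤ} (hz : z ∈ rect L) :
    extendName (fun w : rect L => originState (shift w.1 ω)) z = ω z := by
  simp only [extendName, hz, dif_pos, originState_shift]
  cases ω z <;> simp

/-- A name on `rect L` forces a constraint on the firing variables of every block whose inner sites
it occupies differently. -/
lemma atom_real_le (p ρ : I) (L : ℕ) (a : rect L → Fin 2) :
    ((stationaryLaw p ρ).map particles).real
        {ω | ∀ z : rect L, originState (shift z.1 ω) = a z} ≤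
      blockProb p ^ ((blocks L).filter fun z =>
        extendName a (3 * z.1, z.2) ≠ extendName a (3 * z.1 + 1, z.2)).card := by
  refine le_trans ?_ (stirLaw_real_blocks_le p _ fun z =>
    (extendName a (3 * z.1, z.2) ^^ extendName a (3 * z.1, z.2 + 1)))
  set S := {s : StirField | ∀ z ∈ (blocks L).filter fun z =>
      extendName a (3 * z.1, z.2) ≠ extendName a (3 * z.1 + 1, z.2),
    (s (3 * z.1 - 1, z.2)).1 = false → (s (3 * z.1 + 1, z.2)).1 = false →
      (s (3 * z.1, z.2)).1 =
        (extendName a (3 * z.1, z.2) ^^ extendName a (3 * z.1, z.2 + 1))}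
  have hrw : (stirLaw p).real S = ((initLaw ρ).prod (stirLaw p)).real (Set.univ ×ˢ S) := by
    rw [measureReal_prod_prod]
    simp
  rw [hrw, particleLaw_eq, map_measureReal_apply (measurable_particles.comp measurable_spaceTime)
    (measurableSet_atom measurable_shift measurable_originState _ a)]
  refine measureReal_mono fun q hq => ⟨trivial, fun z hz h₁ h₂ => ?_⟩
  have ha : a = fun w : rect L => originState (shift w.1 (particles (spaceTime q))) :=
    funext fun w => (hq w).symm
  obtain ⟨hz, hne⟩ := Finset.mem_filter.1 hz
  obtain ⟨m₁, m₂, m₃⟩ := mem_rect_of_mem_blocks hz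
  rw [ha, extendName_eq _ m₁, extendName_eq _ m₂] at hne
  rw [ha, extendName_eq _ m₁, extendName_eq _ m₃]
  exact fires_of_isolated q h₁ h₂ hne

/-- The probability that two neighbouring sites are occupied differently. -/
def unequalProb (p ρ : I) : ℝ :=
  ((stationaryLaw p ρ).map particles).real {ω | ω (0, 0) ≠ ω (1, 0)}

lemma measurableSet_ne (z w : ℤ × ℤ) : MeasurableSet {ω : ℤ × ℤ → Bool | ω z ≠ ω w} :=
  (measurableSet_eq_fun (measurable_pi_apply z) (measurable_pi_apply w)).compl

lemma measurePreserving_shift_particleLaw (p ρ : I) (z : ℤ × ℤ) :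
    MeasurePreserving (shift z) ((stationaryLaw p ρ).map particles)
      ((stationaryLaw p ρ).map particles) := by
  refine ⟨measurable_shift z, ?_⟩
  have h : shift z ∘ particles = particles ∘ shift z := funext fun _ => rfl
  rw [Measure.map_map (measurable_shift z) measurable_particles, h,
    ← Measure.map_map measurable_particles (measurable_shift z),
    (measurePreserving_shift_stationaryLaw p ρ z).map_eq]

lemma unequalProb_eq (p ρ : I) (x t : ℤ) :
    ((stationaryLaw p ρ).map particles).real {ω | ω (x, t) ≠ ω (x + 1, t)} =
      unequalProb p ρ := by
  have h := (measurePreserving_shift_particleLaw p ρ (x, t)).measureReal_preimage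
    (measurableSet_ne (0, 0) (1, 0)).nullMeasurableSet
  simpa [shift, unequalProb, add_comm] using h

lemma unequalProb_pos (p : I) {ρ : I} (hρ₀ : 0 < ρ) (hρ₁ : ρ < 1) : 0 < unequalProb p ρ := by
  have h₀ : (0 : ℝ) < ρ := hρ₀
  have h₁ : (0 : ℝ) < 1 - ρ := sub_pos.2 hρ₁
  rw [unequalProb, particleLaw_eq, map_measureReal_apply
    (measurable_particles.comp measurable_spaceTime) (measurableSet_ne _ _)]
  set A : Set (ℤ → Bool) := Set.pi ({0, 1} : Finset ℤ) fun x => {decide (x = 0)} with hA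
  have hreal : (initLaw ρ).real A = ρ * (1 - ρ) := by
    rw [measureReal_def, hA, initLaw, Measure.infinitePi_pi _ fun _ _ => measurableSet_singleton _,
      ENNReal.toReal_prod, Finset.prod_pair zero_ne_one]
    simp
  have hsub : A ×ˢ (Set.univ : Set StirField) ⊆
      particles ∘ spaceTime ⁻¹' {ω | ω (0, 0) ≠ ω (1, 0)} := by
    rintro ⟨η, s⟩ ⟨hη, -⟩
    have e₀ : η 0 = true := by simpa using hη 0 (by simp)
    have e₁ : η 1 = false := by simpa using hη 1 (by simp)
    simp [particles, spaceTime, timeMap_zero, e₀, e₁]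
  refine lt_of_lt_of_le ?_ (measureReal_mono hsub)
  rw [measureReal_prod_prod, hreal]
  simp only [probReal_univ, mul_one]
  positivity

lemma le_joinEntropy (p ρ : I) (L : ℕ) :
    -Real.log (blockProb p) * ((blocks L).card * unequalProb p ρ) ≤
      joinEntropy ((stationaryLaw p ρ).map particles) shift originState (rect L) := by
  refine le_trans (le_of_eq ?_) (mul_sum_le_joinEntropy measurable_shift measurable_originState
    (rect L) (blocks L)
    (fun z a => extendName a (3 * z.1, z.2) ≠ extendName a (3 * z.1 + 1, z.2))
    (atom_real_le p ρ L))
  rw [← nsmul_eq_mul, ← Finset.sum_const]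
  congr 1
  refine Finset.sum_congr rfl fun z hz => ?_
  obtain ⟨m₁, m₂, -⟩ := mem_rect_of_mem_blocks hz
  rw [← unequalProb_eq p ρ (3 * z.1) z.2]
  congr 1
  ext ω
  simp only [Set.mem_ofPred_eq, extendName_eq ω m₁, extendName_eq ω m₂]

lemma card_rect (L : ℕ) : (rect L).card = (2 * L + 1) ^ 2 := by
  rw [rect, Finset.card_product, Int.card_Icc, sq]
  congr 1 <;> omega

theorem entropy_particleLaw_pos {p ρ : I} (hp₀ : 0 < p) (hp₁ : p < 1) (hρ₀ : 0 < ρ)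
    (hρ₁ : ρ < 1) : 0 < entropy ((stationaryLaw p ρ).map particles) shift := by
  obtain ⟨hb₀, hb₁⟩ := blockProb_mem_Ioo hp₀ hp₁
  have hlog : 0 < -Real.log (blockProb p) := neg_pos.2 (Real.log_neg hb₀ hb₁)
  have hδ := unequalProb_pos p hρ₀ hρ₁
  set c := -Real.log (blockProb p) * unequalProb p ρ / 27 with hc
  have hc₀ : 0 < c := by positivity
  refine lt_of_lt_of_le (EReal.coe_pos.2 hc₀) (le_iSup_of_le 2 (le_iSup_of_le originState
    (le_iSup_of_le measurable_originState (le_liminf_of_le (by isBoundedDefault) ?_))))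
  filter_upwards [eventually_ge_atTop 1] with L hL
  rw [EReal.coe_le_coe_iff, card_rect, le_div_iff₀ (by positivity)]
  refine le_trans ?_ (le_joinEntropy p ρ L)
  -- at least `L ^ 2 / 3` blocks, against `(2 * L + 1) ^ 2 ≤ 9 * L ^ 2` sites
  have hcard : (2 * L + 1) ^ 2 ≤ 27 * (blocks L).card := by
    have : L ≤ 3 * ((L + 2) / 3) := by omega
    rw [card_blocks]
    nlinarith
  have hcard' : (((2 * L + 1) ^ 2 : ℕ) : ℝ) ≤ 27 * ((blocks L).card : ℝ) := by exact_mod_cast hcard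
  calc c * (((2 * L + 1) ^ 2 : ℕ) : ℝ) ≤ c * (27 * ((blocks L).card : ℝ)) := by gcongr
    _ = _ := by rw [hc]; ring

end SSEP

end

theorem mainTheorem6 (p ρ : unitInterval) (hp₀ : 0 < p) (hp₁ : p < 1) (hρ₀ : 0 < ρ) (hρ₁ : ρ < 1) :
    (∃! μ : MeasureTheory.Measure SSEP.Space, SSEP.IsStationaryLaw p ρ μ) ∧
    ∀ μ : MeasureTheory.Measure SSEP.Space, SSEP.IsStationaryLaw p ρ μ →
      MeasureTheory.IsProbabilityMeasure μ ∧
      (∀ z : ℤ × ℤ, MeasureTheory.MeasurePreserving (SSEP.shift z) μ μ) ∧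
      0 < SSEP.entropy μ SSEP.shift ∧
      0 < SSEP.entropy (μ.map SSEP.particles) SSEP.shift := by
  refine ⟨⟨SSEP.stationaryLaw p ρ, SSEP.isStationaryLaw_stationaryLaw p ρ,
    fun μ hμ => hμ.eq_stationaryLaw⟩, fun μ hμ => ?_⟩
  obtain rfl := hμ.eq_stationaryLaw
  have hpos := SSEP.entropy_particleLaw_pos hp₀ hp₁ hρ₀ hρ₁
  exact ⟨inferInstance, SSEP.measurePreserving_shift_stationaryLaw p ρ,
    hpos.trans_le (SSEP.entropy_map_le SSEP.measurable_particles SSEP.measurable_shift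
      SSEP.particles_shift), hpos⟩
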